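/- Let $c_1,c_2,\lambda>0$. A particle starts at the origin at time $0$ with velocity $V(0)$, which equals $c_1$ or $-c_2$ with probability $\tfrac12$ each, and its velocity switches between the two values $c_1$ and $-c_2$ at each event of a homogeneous Poisson process $\{N(s)\}_{s\ge0}$ of rate $\lambda$ that is independent of $V(0)$. Let $V(s)$ be its velocity at time $s$ and let $\mathcal T(s)=\int_0^s V(u)\,du$ be its position (the asymmetric telegraph process). Then, for every integer $k\ge0$, every $t>0$ and every $\beta\in[0,c_1t]$, $$P\Bigl\{\max_{0\le s\le t}\mathcal T(s)\le\beta\ \Big|\ V(0)=-c_2,\ N(t)=2k+1\Bigr\}=\sum_{j=0}^{k}\binom{2k+1}{j}\frac{(c_1t-\beta)^j(c_2t+\beta)^{2k+1-j}}{[(c_1+c_2)t]^{2k+1}}-\sum_{j=0}^{k-1}\binom{2k+1}{j}\Bigl(\frac{c_2}{c_1}\Bigr)^{2k-2j}\frac{(c_1t-\beta)^{2k+1-j}(c_2t+\beta)^j}{[(c_1+c_2)t]^{2k+1}},$$ where the second sum is empty if $k=0$. -/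

import Mathlib

open MeasureTheory ProbabilityTheory Set
open scoped NNReal ENNReal

/-- `N` is a homogeneous Poisson process of rate `lam` under `μ`: there are independent
`Exp(lam)`-distributed interarrival times `W 0, W 1, …` such that almost surely, for every time
`t`, `N t` is the number of arrival times `T_{n+1} = W 0 + ⋯ + W n` lying in `[0, t]`. -/
structure IsPoissonProcess {Ω : Type*} [MeasurableSpace Ω] (μ : Measure Ω) (lam : ℝ)
    (N : ℝ≥0 → Ω → ℕ) : Prop where
  measurable : ∀ t, Measurable (N t)
  exists_interarrival : ∃ W : ℕ → Ω → ℝ,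
    (∀ i, Measurable (W i)) ∧
    (∀ i, μ.map (W i) = expMeasure lam) ∧
    iIndepFun W μ ∧
    ∀ᵐ ω ∂μ, ∀ t : ℝ≥0,
      (N t ω : ℕ∞) = {n : ℕ | ∑ i ∈ Finset.range (n + 1), W i ω ≤ (t : ℝ)}.encard

/-- The velocity at time `s`: it starts at `V₀ ∈ {c₁, -c₂}` and switches between the values
`c₁` and `-c₂` (whose sum is `c₁ - c₂`) at each event of `N`. -/
noncomputable def telegraphVelocity {Ω : Type*} (c₁ c₂ : ℝ) (V₀ : Ω → ℝ) (N : ℝ≥0 → Ω → ℕ)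
    (s : ℝ≥0) (ω : Ω) : ℝ :=
  if Even (N s ω) then V₀ ω else c₁ - c₂ - V₀ ω

/-- The position at time `s` of the particle starting from the origin. -/
noncomputable def telegraphPosition {Ω : Type*} (c₁ c₂ : ℝ) (V₀ : Ω → ℝ) (N : ℝ≥0 → Ω → ℕ)
    (s : ℝ≥0) (ω : Ω) : ℝ :=
  ∫ u in (0 : ℝ)..s, telegraphVelocity c₁ c₂ V₀ N u.toNNReal ω

/-- The maximum of the position over the time interval `[0, t]`. For a Poisson process `N`, almost
every path is continuous, so that the supremum is attained. -/
noncomputable def telegraphMax {Ω : Type*} (c₁ c₂ : ℝ) (V₀ : Ω → ℝ) (N : ℝ≥0 → Ω → ℕ)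
    (t : ℝ≥0) (ω : Ω) : ℝ :=
  sSup ((fun s : ℝ≥0 => telegraphPosition c₁ c₂ V₀ N s ω) '' Icc 0 t)

/-- `V₀` and `N` drive an asymmetric telegraph process: the initial velocity `V₀` equals `c₁` or
`-c₂` with probability `1/2` each, and the switches are paced by a Poisson process `N` of rate
`lam`, independent of `V₀`. -/
structure IsTelegraphDriver {Ω : Type*} [MeasurableSpace Ω] (μ : Measure Ω) (c₁ c₂ lam : ℝ)
    (V₀ : Ω → ℝ) (N : ℝ≥0 → Ω → ℕ) : Prop where
  measurable_initial : Measurable V₀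
  initial_pos : μ {ω | V₀ ω = c₁} = 1 / 2
  initial_neg : μ {ω | V₀ ω = -c₂} = 1 / 2
  poisson : IsPoissonProcess μ lam N
  indep : IndepFun V₀ (fun ω s => N s ω) μ

/-! Given the initial velocity, the path is a function of independent exponential interarrival
times. In a product of their densities over a path with exactly `n` switches up to `t`, the
exponentials combine to `lam ^ n * exp (-(lam * t))` whatever the switching times, so conditionally
on `n` switches every probability is a ratio of volumes.

The volumes follow from conditioning on one run at a time. Write `t = u + v` and `β = c₁ * v - c₂ *
u`: `u` and `v` are the total times spent going down and up by a path that is at `β` at time `t`.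
After a downward run of length `x` the remaining problem has parameters `(u - x, v)`; after an
upward one, `(u, v - x)`. An upward run must end below the level, i.e. `v - x ≥ (c₂ / c₁) * u`; a
downward run with `x > u` puts the level out of reach, and then only the number of switches matters.
This gives two integral recursions, solved by `downVol` and `upVol` (`integral_downVol`,
`integral_upVol`), and `measureReal_staysBelow` follows by induction.

Two links to the process remain: the maximum is controlled by the ends of upward runs
(`telegraphMax_le_iff_staysBelow`), and the interarrival times, being measurable functions of `N`,
are independent of `V₀` (`indepFun_interarrival`). -/

/-- `W` is a sequence of independent `Exp(lam)`-distributed random variables. -/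
structure IsExpSeq {Ω : Type*} [MeasurableSpace Ω] (μ : Measure Ω) (lam : ℝ)
    (W : ℕ → Ω → ℝ) : Prop where
  measurable : ∀ i, Measurable (W i)
  law : ∀ i, μ.map (W i) = expMeasure lam
  indep : iIndepFun W μ

/-! ### Arrival times. -/

/-- The sequence without its first term. -/
def seqTail (w : ℕ → ℝ) : ℕ → ℝ := fun i => w (i + 1)

/-- The `n`-th arrival time, given the interarrival times `w`. -/
def arrival (w : ℕ → ℝ) (n : ℕ) : ℝ := ∑ i ∈ Finset.range n, w i

/-- Exactly `n` arrivals occur up to time `t`. -/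
def CountEq (n : ℕ) (t : ℝ) (w : ℕ → ℝ) : Prop := arrival w n ≤ t ∧ t < arrival w (n + 1)

lemma arrival_succ' (w : ℕ → ℝ) (n : ℕ) : arrival w (n + 1) = w 0 + arrival (seqTail w) n := by
  simp [arrival, seqTail, Finset.sum_range_succ', add_comm]

lemma arrival_succ (w : ℕ → ℝ) (n : ℕ) : arrival w (n + 1) = arrival w n + w n := by
  simp [arrival, Finset.sum_range_succ]

lemma arrival_zero (w : ℕ → ℝ) : arrival w 0 = 0 := by simp [arrival]

lemma arrival_mono {w : ℕ → ℝ} (hw : ∀ i, 0 ≤ w i) : Monotone (arrival w) :=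
  monotone_nat_of_le_succ fun n => by rw [arrival_succ]; linarith [hw n]

lemma arrival_nonneg {w : ℕ → ℝ} (hw : ∀ i, 0 ≤ w i) (n : ℕ) : 0 ≤ arrival w n :=
  Finset.sum_nonneg fun i _ => hw i

lemma countEq_succ (n : ℕ) (t : ℝ) (w : ℕ → ℝ) :
    CountEq (n + 1) t w ↔ CountEq n (t - w 0) (seqTail w) := by
  simp only [CountEq, arrival_succ' w]
  constructor <;> rintro ⟨h₁, h₂⟩ <;> constructor <;> linarith

@[fun_prop]
lemma measurable_seqTail : Measurable seqTail :=
  measurable_pi_lambda _ fun i => measurable_pi_apply (i + 1)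

@[fun_prop]
lemma measurable_arrival (n : ℕ) : Measurable fun w => arrival w n := by
  unfold arrival; fun_prop

lemma measurableSet_countEq (n : ℕ) : MeasurableSet {p : ℝ × (ℕ → ℝ) | CountEq n p.1 p.2} := by
  have h : ∀ n, Measurable fun p : ℝ × (ℕ → ℝ) => arrival p.2 n :=
    fun n => (measurable_arrival n).comp measurable_snd
  exact (measurableSet_le (h n) measurable_fst).inter (measurableSet_lt measurable_fst (h (n + 1)))

lemma measurable_gammaPDF (a r : ℝ) : Measurable (gammaPDF a r) :=
  (measurable_gammaPDFReal a r).ennreal_ofReal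

/-! ### First-step analysis for exponential interarrival times. -/

namespace IsExpSeq

variable {Ω : Type*} [MeasurableSpace Ω] {μ : Measure Ω} {lam : ℝ} {W : ℕ → Ω → ℝ}

lemma tail (h : IsExpSeq μ lam W) : IsExpSeq μ lam fun i => W (i + 1) where
  measurable _ := h.measurable _
  law _ := h.law _
  indep := h.indep.precomp (add_left_injective 1)

lemma measurable_seq (h : IsExpSeq μ lam W) : Measurable fun ω i => W i ω :=
  measurable_pi_lambda _ h.measurable

lemma indepFun_head_tail (h : IsExpSeq μ lam W) :
    IndepFun (W 0) (fun ω i => W (i + 1) ω) μ := by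
  have key := indep_iSup_of_disjoint (m := fun i => (inferInstance : MeasurableSpace ℝ).comap (W i))
    (μ := μ) (S := {0}) (T := {0}ᶜ) (fun i => (h.measurable i).comap_le) h.indep
    disjoint_compl_right
  rw [IndepFun_iff_Indep]
  refine indep_of_indep_of_le_left (indep_of_indep_of_le_right key ?_) ?_
  · rw [MeasurableSpace.pi, MeasurableSpace.comap_iSup]
    refine iSup_le fun i => ?_
    rw [MeasurableSpace.comap_comp]
    exact le_iSup₂_of_le (i + 1) (by simp) le_rfl
  · exact le_iSup₂_of_le 0 (by simp) le_rfl

lemma ae_nonneg (h : IsExpSeq μ lam W) : ∀ᵐ ω ∂μ, ∀ i, 0 ≤ W i ω := by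
  rw [ae_all_iff]
  intro i
  have : ∀ᵐ x ∂(μ.map (W i)), 0 ≤ x := by
    rw [h.law i, expMeasure, gammaMeasure,
      ae_withDensity_iff (measurable_gammaPDF 1 lam)]
    refine Filter.Eventually.of_forall fun x hx => ?_
    by_contra hneg
    exact hx (gammaPDF_of_neg (not_le.1 hneg))
  exact ae_of_ae_map (h.measurable i).aemeasurable this

/-- Conditioning on the first term of the sequence. -/
lemma measureReal_head_tail [IsProbabilityMeasure μ] (hlam : 0 < lam) (h : IsExpSeq μ lam W)
    {S : Set (ℝ × (ℕ → ℝ))} (hS : MeasurableSet S) :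
    μ.real {ω | (W 0 ω, fun i => W (i + 1) ω) ∈ S} =
      ∫ x in Ioi 0, lam * Real.exp (-(lam * x)) *
        μ.real {ω | (x, fun i => W (i + 1) ω) ∈ S} := by
  have hm := h.measurable 0
  have hm' := h.tail.measurable_seq
  have hpair := (indepFun_iff_map_prod_eq_prod_map_map hm.aemeasurable hm'.aemeasurable).1
    h.indepFun_head_tail
  have : IsProbabilityMeasure (μ.map fun ω i => W (i + 1) ω) :=
    Measure.isProbabilityMeasure_map hm'.aemeasurable
  set ν := μ.map fun ω i => W (i + 1) ω
  have h1 : μ.real {ω | (W 0 ω, fun i => W (i + 1) ω) ∈ S} =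
      ∫ x, ν.real (Prod.mk x ⁻¹' S) ∂(expMeasure lam) := by
    rw [← h.law 0]
    simp only [measureReal_def]
    rw [integral_toReal (measurable_measure_prodMk_left hS).aemeasurable
      (Filter.Eventually.of_forall fun _ => measure_lt_top _ _), ← Measure.prod_apply hS, ← hpair,
      Measure.map_apply (hm.prodMk hm') hS]
    rfl
  have h2 : ∀ x, ν.real (Prod.mk x ⁻¹' S) = μ.real {ω | (x, fun i => W (i + 1) ω) ∈ S} :=
    fun x => by
      simp only [measureReal_def, ν]
      rw [Measure.map_apply hm' (measurable_prodMk_left hS)]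
      rfl
  -- The density is given by its formula at `0` too, so the half-line is closed before passing to
  -- indicators.
  rw [h1, expMeasure, gammaMeasure, integral_withDensity_eq_integral_toReal_smul
    (measurable_gammaPDF 1 lam)
    (Filter.Eventually.of_forall fun _ => ENNReal.ofReal_lt_top),
    ← integral_Ici_eq_integral_Ioi, ← integral_indicator measurableSet_Ici]
  refine integral_congr_ae (Filter.Eventually.of_forall fun x => ?_)
  by_cases hx : 0 ≤ x
  · rw [indicator_of_mem (mem_Ici.2 hx)]
    simp only [h2, smul_eq_mul]
    congr 1
    change (exponentialPDF lam x).toReal = _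
    rw [exponentialPDF_of_nonneg hx, ENNReal.toReal_ofReal (by positivity)]
  · rw [indicator_of_notMem (by simpa using hx)]
    simp [gammaPDF_of_neg (not_le.1 hx)]

/-- Conditioning on the first term, when the conditional probabilities are given by one formula
below `a`, by another one between `a` and `b`, and vanish above `b`. -/
lemma measureReal_eq_integral [IsProbabilityMeasure μ] (hlam : 0 < lam) (h : IsExpSeq μ lam W)
    {S : Set (ℝ × (ℕ → ℝ))} (hS : MeasurableSet S) (n : ℕ) (t : ℝ) {a b : ℝ} (ha : 0 ≤ a)
    (hab : a ≤ b) {f g : ℝ → ℝ} (hf : Continuous f) (hg : Continuous g)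
    (hfS : ∀ x, 0 < x → x < a → μ.real {ω | (x, fun i => W (i + 1) ω) ∈ S} =
      lam ^ n * Real.exp (-(lam * (t - x))) * f x)
    (hgS : ∀ x, a < x → x ≤ b → μ.real {ω | (x, fun i => W (i + 1) ω) ∈ S} =
      lam ^ n * Real.exp (-(lam * (t - x))) * g x)
    (hzS : ∀ x, b < x → μ.real {ω | (x, fun i => W (i + 1) ω) ∈ S} = 0) :
    μ.real {ω | (W 0 ω, fun i => W (i + 1) ω) ∈ S} =
      lam ^ (n + 1) * Real.exp (-(lam * t)) * ((∫ x in (0 : ℝ)..a, f x) + ∫ x in a..b, g x) := by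
  rw [h.measureReal_head_tail hlam hS]
  set p : ℝ → ℝ := fun x => μ.real {ω | (x, fun i => W (i + 1) ω) ∈ S}
  -- The product of the two exponentials no longer depends on `x`: only the integrals of `f` and `g`
  -- remain.
  have hexp : ∀ x y, lam * Real.exp (-(lam * x)) * (lam ^ n * Real.exp (-(lam * (t - x))) * y) =
      lam ^ (n + 1) * Real.exp (-(lam * t)) * y := by
    intro x y
    have : Real.exp (-(lam * t)) = Real.exp (-(lam * x)) * Real.exp (-(lam * (t - x))) := by
      rw [← Real.exp_add]; ring_nf
    rw [this]; ring
  have hb : Ioc 0 b ⊆ Ioi (0 : ℝ) := fun x hx => hx.1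
  have hsplit : Ioc (0 : ℝ) b = Ioc 0 a ∪ Ioc a b := (Ioc_union_Ioc_eq_Ioc ha hab).symm
  set q : ℝ → ℝ := fun x => lam * Real.exp (-(lam * x)) * p x
  set F : ℝ → ℝ := fun x => lam ^ (n + 1) * Real.exp (-(lam * t)) * f x
  set G : ℝ → ℝ := fun x => lam ^ (n + 1) * Real.exp (-(lam * t)) * g x
  have hF : F =ᵐ[volume.restrict (Ioc 0 a)] q := by
    rw [← restrict_Ioo_eq_restrict_Ioc]
    filter_upwards [ae_restrict_mem measurableSet_Ioo] with x hx
    simp only [F, q, p, hfS x hx.1 hx.2, hexp]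
  have hG : G =ᵐ[volume.restrict (Ioc a b)] q := by
    filter_upwards [ae_restrict_mem measurableSet_Ioc] with x hx
    simp only [G, q, p, hgS x hx.1 hx.2, hexp]
  have hFi : IntegrableOn F (Ioc 0 a) :=
    ((hf.const_mul _).integrableOn_Icc).mono_set Ioc_subset_Icc_self
  have hGi : IntegrableOn G (Ioc a b) :=
    ((hg.const_mul _).integrableOn_Icc).mono_set Ioc_subset_Icc_self
  calc ∫ x in Ioi 0, q x = ∫ x in Ioc 0 b, q x := by
        refine (setIntegral_eq_of_subset_of_forall_sdiff_eq_zero measurableSet_Ioi hb ?_)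
        intro x hx
        have : b < x := by
          by_contra hc
          exact hx.2 ⟨hx.1, not_lt.1 hc⟩
        simp only [q, p, hzS x this, mul_zero]
    _ = (∫ x in Ioc 0 a, q x) + ∫ x in Ioc a b, q x := by
        rw [hsplit]
        refine setIntegral_union (Ioc_disjoint_Ioc_of_le le_rfl) measurableSet_Ioc
          (hFi.congr hF) (hGi.congr hG)
    _ = (∫ x in Ioc 0 a, F x) + ∫ x in Ioc a b, G x := by
        rw [integral_congr_ae hF, integral_congr_ae hG]
    _ = _ := by
        rw [← intervalIntegral.integral_of_le ha, ← intervalIntegral.integral_of_le hab]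
        simp only [F, G, intervalIntegral.integral_const_mul]
        ring

lemma measureReal_countEq_of_neg (h : IsExpSeq μ lam W) (n : ℕ) {t : ℝ} (ht : t < 0) :
    μ.real {ω | CountEq n t fun i => W i ω} = 0 := by
  rw [measureReal_def, measure_eq_zero_iff_ae_notMem.2, ENNReal.toReal_zero]
  filter_upwards [h.ae_nonneg] with ω hω hc
  linarith [hc.1, arrival_nonneg hω n]

lemma measurableSet_countEq_section (n : ℕ) (t : ℝ) :
    MeasurableSet {p : ℝ × (ℕ → ℝ) | CountEq n (t - p.1) p.2} :=
  (measurableSet_countEq n).preimage (f := fun p : ℝ × (ℕ → ℝ) => (t - p.1, p.2)) (by fun_prop)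

/-- The Poisson law. Each conditioning on the first interarrival time integrates the volume `t ^ n /
n!` of the simplex once more. -/
lemma measureReal_countEq [IsProbabilityMeasure μ] (hlam : 0 < lam) (h : IsExpSeq μ lam W)
    (n : ℕ) {t : ℝ} (ht : 0 ≤ t) :
    μ.real {ω | CountEq n t fun i => W i ω} =
      lam ^ n * Real.exp (-(lam * t)) * (t ^ n / n.factorial) := by
  induction n generalizing W t with
  | zero =>
    have h1 : μ.real {ω | CountEq 0 t fun i => W i ω} = (expMeasure lam).real (Ioi t) := by
      rw [← h.law 0, map_measureReal_apply (h.measurable 0) measurableSet_Ioi]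
      congr 1
      ext ω
      simp [CountEq, arrival, ht]
    have := isProbabilityMeasure_expMeasure hlam
    rw [h1, ← compl_Iic, probReal_compl_eq_one_sub measurableSet_Iic, ← cdf_eq_real,
      cdf_expMeasure_eq hlam, if_pos ht]
    simp
  | succ n ih =>
    have h1 : {ω | CountEq (n + 1) t fun i => W i ω} =
        {ω | (W 0 ω, fun i => W (i + 1) ω) ∈ {p : ℝ × (ℕ → ℝ) | CountEq n (t - p.1) p.2}} := by
      ext ω
      exact countEq_succ _ _ _
    rw [h1, h.measureReal_eq_integral hlam (measurableSet_countEq_section n t) n t le_rfl ht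
      (f := fun _ => 0) (g := fun x => (t - x) ^ n / n.factorial) (by fun_prop) (by fun_prop)
      (fun x hx hx' => absurd hx hx'.not_gt) (fun x _ hx => ih h.tail (t := t - x) (by linarith))
      (fun x hx => h.tail.measureReal_countEq_of_neg n (t := t - x) (by linarith))]
    congr 1
    rw [intervalIntegral.integral_same, zero_add, intervalIntegral.integral_div,
      intervalIntegral.integral_comp_sub_left (fun x => x ^ n), integral_pow, Nat.factorial_succ]
    simp
    field_simp

end IsExpSeq

/-! ### Paths that stay below a level. -/

/-- The position at the `n`-th switch of a path starting with velocity `-c₂`. -/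
noncomputable def switchPos (c₁ c₂ : ℝ) (w : ℕ → ℝ) (n : ℕ) : ℝ :=
  ∑ i ∈ Finset.range n, (if Even i then -c₂ else c₁) * w i

/-- The path starting with velocity `-c₂` has `2 * k + 1` switches up to time `t`, and its local
maxima at positive times up to `t` are at most `β`. -/
def StaysBelow (c₁ c₂ : ℝ) (k : ℕ) (t β : ℝ) (w : ℕ → ℝ) : Prop :=
  CountEq (2 * k + 1) t w ∧ (∀ i < k, switchPos c₁ c₂ w (2 * i + 2) ≤ β) ∧
    switchPos c₁ c₂ w (2 * k + 1) + c₁ * (t - arrival w (2 * k + 1)) ≤ β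

/-- The analogue of `StaysBelow` for a path starting with velocity `c₁`. -/
def StaysBelowUp (c₁ c₂ : ℝ) (k : ℕ) (t β : ℝ) (w : ℕ → ℝ) : Prop :=
  c₁ * w 0 ≤ β ∧ StaysBelow c₁ c₂ k (t - w 0) (β - c₁ * w 0) (seqTail w)

section Below

variable {c₁ c₂ : ℝ}

lemma switchPos_add_two (w : ℕ → ℝ) (n : ℕ) :
    switchPos c₁ c₂ w (n + 2) = -c₂ * w 0 + c₁ * w 1 +
      switchPos c₁ c₂ (seqTail (seqTail w)) n := by
  simp only [switchPos, Finset.sum_range_succ', seqTail]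
  simp [Nat.even_add]
  ring

lemma switchPos_succ (w : ℕ → ℝ) (n : ℕ) :
    switchPos c₁ c₂ w (n + 1) = switchPos c₁ c₂ w n + (if Even n then -c₂ else c₁) * w n := by
  simp [switchPos, Finset.sum_range_succ]

lemma switchPos_zero (w : ℕ → ℝ) : switchPos c₁ c₂ w 0 = 0 := by simp [switchPos]

@[fun_prop]
lemma measurable_switchPos (n : ℕ) : Measurable fun w => switchPos c₁ c₂ w n := by
  unfold switchPos; fun_prop

lemma switchPos_le (hc₁ : 0 < c₁) (hc₂ : 0 < c₂) {w : ℕ → ℝ} (hw : ∀ i, 0 ≤ w i) (n : ℕ) :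
    switchPos c₁ c₂ w n ≤ c₁ * arrival w n := by
  rw [switchPos, arrival, Finset.mul_sum]
  refine Finset.sum_le_sum fun i _ => mul_le_mul_of_nonneg_right ?_ (hw i)
  split_ifs <;> linarith

/-- With a single switch at `w 0`, the only condition on the level is at the final time, where the
position is `c₁ * t - (c₁ + c₂) * w 0`. -/
lemma staysBelow_zero (t β : ℝ) (w : ℕ → ℝ) : StaysBelow c₁ c₂ 0 t β w ↔
    CountEq 0 (t - w 0) (seqTail w) ∧ c₁ * t - (c₁ + c₂) * w 0 ≤ β := by
  rw [StaysBelow, mul_zero, countEq_succ]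
  simp only [switchPos, arrival, not_lt_zero, false_imp_iff, implies_true, true_and]
  simp
  intro _
  constructor <;> intro h <;> linarith

/-- Restarting at the first switch, where the particle is at `-c₂ * w 0`, raises the level by `c₂ *
w 0` relative to the particle. -/
lemma staysBelow_succ (k : ℕ) (t β : ℝ) (w : ℕ → ℝ) : StaysBelow c₁ c₂ (k + 1) t β w ↔
    StaysBelowUp c₁ c₂ k (t - w 0) (β + c₂ * w 0) (seqTail w) := by
  have e : 2 * (k + 1) + 1 = 2 * k + 1 + 1 + 1 := by ring
  have e' : 2 * (k + 1) + 1 = 2 * k + 1 + 2 := by ring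
  have h1 : CountEq (2 * (k + 1) + 1) t w ↔
      CountEq (2 * k + 1) (t - w 0 - seqTail w 0) (seqTail (seqTail w)) := by
    rw [e, countEq_succ, countEq_succ]
  have h2 : (∀ i < k + 1, switchPos c₁ c₂ w (2 * i + 2) ≤ β) ↔ c₁ * seqTail w 0 ≤ β + c₂ * w 0 ∧
      ∀ i < k, switchPos c₁ c₂ (seqTail (seqTail w)) (2 * i + 2) ≤
        β + c₂ * w 0 - c₁ * seqTail w 0 := by
    rw [Nat.forall_lt_succ_left]
    refine and_congr ?_ (forall₂_congr fun i _ => ?_)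
    · rw [mul_zero, switchPos_add_two, switchPos_zero]
      simp only [seqTail]
      constructor <;> intro h <;> linarith
    · rw [switchPos_add_two, mul_add]
      simp only [seqTail]
      constructor <;> intro h <;> linarith
  have h3 : switchPos c₁ c₂ w (2 * (k + 1) + 1) + c₁ * (t - arrival w (2 * (k + 1) + 1)) ≤ β ↔
      switchPos c₁ c₂ (seqTail (seqTail w)) (2 * k + 1) + c₁ * (t - w 0 - seqTail w 0 -
        arrival (seqTail (seqTail w)) (2 * k + 1)) ≤ β + c₂ * w 0 - c₁ * seqTail w 0 := by
    rw [e', switchPos_add_two, arrival_succ', arrival_succ']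
    simp only [seqTail]
    constructor <;> intro h <;> linarith
  rw [StaysBelow, StaysBelowUp, StaysBelow, h1, h2, h3]
  tauto

/-- If the particle cannot reach `β` up to time `t`, then only the number of switches matters. -/
lemma staysBelow_iff_countEq (hc₁ : 0 < c₁) (hc₂ : 0 < c₂) {w : ℕ → ℝ} (hw : ∀ i, 0 ≤ w i)
    (k : ℕ) {t β : ℝ} (hβ : c₁ * t ≤ β) :
    StaysBelow c₁ c₂ k t β w ↔ CountEq (2 * k + 1) t w := by
  refine ⟨fun h => h.1, fun h => ⟨h, fun i hi => ?_, ?_⟩⟩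
  · have h1 := switchPos_le hc₁ hc₂ hw (2 * i + 2)
    have h2 := arrival_mono hw (show 2 * i + 2 ≤ 2 * k + 1 by omega)
    have h3 := mul_le_mul_of_nonneg_left (h2.trans h.1) hc₁.le
    linarith
  · linarith [switchPos_le hc₁ hc₂ hw (2 * k + 1)]

lemma staysBelowUp_iff_countEq (hc₁ : 0 < c₁) (hc₂ : 0 < c₂) {w : ℕ → ℝ} (hw : ∀ i, 0 ≤ w i)
    (k : ℕ) {t β : ℝ} (hβ : c₁ * t ≤ β) :
    StaysBelowUp c₁ c₂ k t β w ↔ CountEq (2 * k + 2) t w := by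
  rw [StaysBelowUp, staysBelow_iff_countEq hc₁ hc₂ (w := seqTail w) (fun i => hw (i + 1)) k (by linarith),
    ← countEq_succ, and_iff_right_iff_imp]
  intro h
  have h1 : w 0 ≤ t := by
    have := arrival_mono hw (show 1 ≤ 2 * k + 2 by omega)
    rw [show arrival w 1 = w 0 by simp [arrival]] at this
    exact this.trans h.1
  exact (mul_le_mul_of_nonneg_left h1 hc₁.le).trans hβ

lemma measurableSet_staysBelow (k : ℕ) :
    MeasurableSet {p : ℝ × ℝ × (ℕ → ℝ) | StaysBelow c₁ c₂ k p.1 p.2.1 p.2.2} := by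
  have h : ∀ n, Measurable fun p : ℝ × ℝ × (ℕ → ℝ) => switchPos c₁ c₂ p.2.2 n :=
    fun n => (measurable_switchPos n).comp measurable_snd.snd
  have h' : ∀ n, Measurable fun p : ℝ × ℝ × (ℕ → ℝ) => arrival p.2.2 n :=
    fun n => (measurable_arrival n).comp measurable_snd.snd
  refine ((measurableSet_countEq (2 * k + 1)).preimage
    (f := fun p : ℝ × ℝ × (ℕ → ℝ) => (p.1, p.2.2)) (by fun_prop)).inter (.inter ?_ ?_)
  · have : ∀ i, MeasurableSet
        {p : ℝ × ℝ × (ℕ → ℝ) | i < k → switchPos c₁ c₂ p.2.2 (2 * i + 2) ≤ p.2.1} := fun i =>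
      (MeasurableSet.const _).imp (measurableSet_le (h _) measurable_snd.fst)
    have e : {p : ℝ × ℝ × (ℕ → ℝ) | ∀ i < k, switchPos c₁ c₂ p.2.2 (2 * i + 2) ≤ p.2.1} =
        ⋂ i, {p | i < k → switchPos c₁ c₂ p.2.2 (2 * i + 2) ≤ p.2.1} := by
      ext p
      simp
    exact (e ▸ MeasurableSet.iInter this : MeasurableSet
      {p : ℝ × ℝ × (ℕ → ℝ) | ∀ i < k, switchPos c₁ c₂ p.2.2 (2 * i + 2) ≤ p.2.1})
  · exact measurableSet_le ((h _).add ((measurable_fst.sub (h' _)).const_mul c₁)) measurable_snd.fst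

lemma measurableSet_staysBelowUp (k : ℕ) :
    MeasurableSet {p : ℝ × ℝ × (ℕ → ℝ) | StaysBelowUp c₁ c₂ k p.1 p.2.1 p.2.2} := by
  have h0 : Measurable fun p : ℝ × ℝ × (ℕ → ℝ) => p.2.2 0 := by fun_prop
  have ht : Measurable fun p : ℝ × ℝ × (ℕ → ℝ) => seqTail p.2.2 :=
    measurable_seqTail.comp measurable_snd.snd
  refine (measurableSet_le (h0.const_mul c₁) measurable_snd.fst).inter ?_
  exact (measurableSet_staysBelow k).preimage
    ((measurable_fst.sub h0).prodMk ((measurable_snd.fst.sub (h0.const_mul c₁)).prodMk ht))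

/-! ### The volume polynomials -/

/-- The normalized power `x ^ j / j!`. -/
noncomputable def divPow (j : ℕ) (x : ℝ) : ℝ := x ^ j / j.factorial

@[fun_prop]
lemma continuous_divPow (j : ℕ) : Continuous (divPow j) := by unfold divPow; fun_prop

lemma integral_divPow (j : ℕ) (a b : ℝ) :
    ∫ x in a..b, divPow j x = divPow (j + 1) b - divPow (j + 1) a := by
  simp only [divPow, intervalIntegral.integral_div, integral_pow, Nat.factorial_succ]
  push_cast
  field_simp

lemma divPow_zero_right (j : ℕ) : divPow (j + 1) 0 = 0 := by simp [divPow]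

lemma divPow_zero_left (x : ℝ) : divPow 0 x = 1 := by simp [divPow]

lemma divPow_mul (j : ℕ) (r x : ℝ) : divPow j (r * x) = r ^ j * divPow j x := by
  simp only [divPow]; ring

/-- The volume of the set of `2 * k + 1` interarrival times whose path, starting with velocity
`-c₂`, stays below the level `β`, in the coordinates `u`, `v`. -/
noncomputable def downVol (r : ℝ) (k : ℕ) (u v : ℝ) : ℝ :=
  ∑ j ∈ Finset.range (k + 1), divPow j u * divPow (2 * k + 1 - j) v -
    ∑ j ∈ Finset.range k, r ^ (2 * (k - j)) * divPow (2 * k + 1 - j) u * divPow j v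

/-- The analogue of `downVol` for paths starting with velocity `c₁` and having `2 * k + 2`
switches. -/
noncomputable def upVol (r : ℝ) (k : ℕ) (u v : ℝ) : ℝ :=
  ∑ j ∈ Finset.range (k + 1), divPow j u * divPow (2 * k + 2 - j) v -
    ∑ j ∈ Finset.range (k + 1), r ^ (2 * (k + 1 - j)) * divPow (2 * k + 2 - j) u * divPow j v

lemma continuous_downVol (r : ℝ) (k : ℕ) (u : ℝ) : Continuous (downVol r k u) := by
  unfold downVol; fun_prop

lemma continuous_upVol (r : ℝ) (k : ℕ) (v : ℝ) : Continuous fun u => upVol r k u v := by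
  unfold upVol; fun_prop

/-- Integration raises the index of the `v` factor, and the two sums cancel term by term at the
lower limit `r * u`; the powers of `r` are chosen for this. -/
lemma integral_downVol (r : ℝ) (k : ℕ) (u v : ℝ) :
    ∫ w in (r * u)..v, downVol r k u w = upVol r k u v := by
  have hint : ∀ f : ℝ → ℝ, Continuous f → IntervalIntegrable f volume (r * u) v :=
    fun f hf => hf.intervalIntegrable _ _
  unfold downVol
  rw [intervalIntegral.integral_sub (hint _ (by fun_prop)) (hint _ (by fun_prop)),
    intervalIntegral.integral_finsetSum fun _ _ => hint _ (by fun_prop),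
    intervalIntegral.integral_finsetSum fun _ _ => hint _ (by fun_prop)]
  simp only [intervalIntegral.integral_const_mul, integral_divPow]
  -- The shift of index creates a term `j = 0`, which is zero because `divPow 0` is constant.
  have h1 : ∑ j ∈ Finset.range k, r ^ (2 * (k - j)) * divPow (2 * k + 1 - j) u *
        (divPow (j + 1) v - divPow (j + 1) (r * u)) =
      ∑ j ∈ Finset.range (k + 1), r ^ (2 * (k + 1 - j)) * divPow (2 * k + 2 - j) u *
        (divPow j v - divPow j (r * u)) := by
    rw [Finset.sum_range_succ']
    simp only [divPow_zero_left, sub_self, mul_zero, add_zero]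
    refine Finset.sum_congr rfl fun j _ => ?_
    rw [show k + 1 - (j + 1) = k - j by omega, show 2 * k + 2 - (j + 1) = 2 * k + 1 - j by omega]
  rw [h1, upVol, ← Finset.sum_sub_distrib, ← Finset.sum_sub_distrib]
  refine Finset.sum_congr rfl fun j hj => ?_
  have hj' : j ≤ k := Nat.lt_succ_iff.1 (Finset.mem_range.1 hj)
  rw [show 2 * k + 1 - j + 1 = 2 * k + 2 - j by omega, divPow_mul, divPow_mul,
    show 2 * k + 2 - j = 2 * (k + 1 - j) + j by omega, pow_add]
  ring

/-- The extra `divPow (2 * k + 3) v` comes from first runs longer than `u`; it supplies the term `j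
= 0` of the first sum, the others having their `u` index raised by one. -/
lemma integral_upVol (r : ℝ) (k : ℕ) (u v : ℝ) :
    (∫ x in (0 : ℝ)..u, upVol r k x v) + divPow (2 * k + 3) v = downVol r (k + 1) u v := by
  have hint : ∀ f : ℝ → ℝ, Continuous f → IntervalIntegrable f volume 0 u :=
    fun f hf => hf.intervalIntegrable _ _
  unfold upVol
  rw [intervalIntegral.integral_sub (hint _ (by fun_prop)) (hint _ (by fun_prop)),
    intervalIntegral.integral_finsetSum fun _ _ => hint _ (by fun_prop),
    intervalIntegral.integral_finsetSum fun _ _ => hint _ (by fun_prop)]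
  simp only [intervalIntegral.integral_const_mul, intervalIntegral.integral_mul_const,
    integral_divPow, divPow_zero_right, sub_zero]
  rw [downVol, Finset.sum_range_succ' _ (k + 1), divPow_zero_left, one_mul]
  have h1 : ∑ j ∈ Finset.range (k + 1), divPow (j + 1) u * divPow (2 * k + 2 - j) v =
      ∑ j ∈ Finset.range (k + 1), divPow (j + 1) u * divPow (2 * (k + 1) + 1 - (j + 1)) v :=
    Finset.sum_congr rfl fun j _ => by
      rw [show 2 * (k + 1) + 1 - (j + 1) = 2 * k + 2 - j by omega]
  have h2 : ∑ j ∈ Finset.range (k + 1),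
        r ^ (2 * (k + 1 - j)) * divPow (2 * k + 2 - j + 1) u * divPow j v =
      ∑ j ∈ Finset.range (k + 1),
        r ^ (2 * (k + 1 - j)) * divPow (2 * (k + 1) + 1 - j) u * divPow j v :=
    Finset.sum_congr rfl fun j hj => by
      have := Finset.mem_range.1 hj
      rw [show 2 * (k + 1) + 1 - j = 2 * k + 2 - j + 1 by omega]
  rw [h1, h2, show 2 * (k + 1) + 1 - 0 = 2 * k + 3 by omega]
  ring

/-! ### Probability of staying below a level. -/

namespace IsExpSeq

variable {Ω : Type*} [MeasurableSpace Ω] {μ : Measure Ω} {lam : ℝ} {W : ℕ → Ω → ℝ}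

lemma measureReal_staysBelowUp_of_neg (h : IsExpSeq μ lam W) (k : ℕ) {t β : ℝ} (ht : t < 0) :
    μ.real {ω | StaysBelowUp c₁ c₂ k t β fun i => W i ω} = 0 := by
  rw [measureReal_def, measure_eq_zero_iff_ae_notMem.2, ENNReal.toReal_zero]
  filter_upwards [h.ae_nonneg] with ω hω hc
  have h1 := hc.2.1.1
  linarith [arrival_nonneg (w := seqTail fun i => W i ω) (fun i => hω (i + 1)) (2 * k + 1), hω 0]

variable [IsProbabilityMeasure μ]

lemma measureReal_staysBelowUp_of_le (hc₁ : 0 < c₁) (hc₂ : 0 < c₂) (hlam : 0 < lam)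
    (h : IsExpSeq μ lam W) (k : ℕ) {t β : ℝ} (ht : 0 ≤ t) (hβ : c₁ * t ≤ β) :
    μ.real {ω | StaysBelowUp c₁ c₂ k t β fun i => W i ω} =
      lam ^ (2 * k + 2) * Real.exp (-(lam * t)) * divPow (2 * k + 2) t := by
  rw [divPow, ← h.measureReal_countEq hlam _ ht]
  refine measureReal_congr ?_
  filter_upwards [h.ae_nonneg] with ω hω
  exact propext (staysBelowUp_iff_countEq hc₁ hc₂ hω k hβ)

lemma measureReal_staysBelow_zero (hc₁ : 0 < c₁) (hc₂ : 0 < c₂) (hlam : 0 < lam)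
    (h : IsExpSeq μ lam W) {u v : ℝ} (hu : 0 ≤ u) (hv : 0 ≤ v) :
    μ.real {ω | StaysBelow c₁ c₂ 0 (u + v) (c₁ * v - c₂ * u) fun i => W i ω} =
      lam * Real.exp (-(lam * (u + v))) * v := by
  set S : Set (ℝ × (ℕ → ℝ)) := {p | CountEq 0 (u + v - p.1) p.2} ∩ {p | u ≤ p.1}
  have h1 : {ω | StaysBelow c₁ c₂ 0 (u + v) (c₁ * v - c₂ * u) fun i => W i ω} =
      {ω | (W 0 ω, fun i => W (i + 1) ω) ∈ S} := by
    ext ω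
    refine (staysBelow_zero _ _ _).trans (and_congr_right fun _ => ?_)
    change _ ↔ u ≤ W 0 ω
    -- For this level the condition reads `(c₁ + c₂) * u ≤ (c₁ + c₂) * W 0 ω`.
    have : 0 < c₁ + c₂ := by linarith
    rw [← mul_le_mul_iff_right₀ this (b := u)]
    constructor <;> intro h' <;> linarith
  have hS : MeasurableSet S := (measurableSet_countEq_section 0 (u + v)).inter
    (measurableSet_le measurable_const measurable_fst)
  rw [h1, h.measureReal_eq_integral hlam hS 0 (u + v) hu (b := u + v) (by linarith)
    (f := fun _ => 0) (g := fun _ => 1) (by fun_prop) (by fun_prop)]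
  · simp
  · intro x _ hx
    simp [S, hx.not_ge]
  · intro x hx hx'
    have := h.tail.measureReal_countEq hlam 0 (t := u + v - x) (by linarith)
    simp only [pow_zero, Nat.factorial_zero, Nat.cast_one, div_one] at this ⊢
    rw [← this]
    congr 1
    ext ω
    simp [S, hx.le]
  · intro x hx
    refine le_antisymm ?_ measureReal_nonneg
    rw [← h.tail.measureReal_countEq_of_neg 0 (t := u + v - x) (by linarith)]
    exact measureReal_mono fun ω hω => hω.1

/-- The first upward run leaves `u` unchanged and turns `v` into `w = v - x`; its end lies below the
level exactly when `w ≥ (c₂ / c₁) * u`, whence the lower limit in `integral_downVol`. -/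
lemma measureReal_staysBelowUp_of_staysBelow (hc₁ : 0 < c₁) (hlam : 0 < lam)
    (h : IsExpSeq μ lam W) (k : ℕ) {u v : ℝ} (huv : c₂ * u ≤ c₁ * v)
    (ih : ∀ w, c₂ * u ≤ c₁ * w →
      μ.real {ω | StaysBelow c₁ c₂ k (u + w) (c₁ * w - c₂ * u) fun i => W (i + 1) ω} =
        lam ^ (2 * k + 1) * Real.exp (-(lam * (u + w))) * downVol (c₂ / c₁) k u w) :
    μ.real {ω | StaysBelowUp c₁ c₂ k (u + v) (c₁ * v - c₂ * u) fun i => W i ω} =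
      lam ^ (2 * k + 2) * Real.exp (-(lam * (u + v))) * upVol (c₂ / c₁) k u v := by
  set S : Set (ℝ × (ℕ → ℝ)) := {p | c₁ * p.1 ≤ c₁ * v - c₂ * u} ∩
    {p | StaysBelow c₁ c₂ k (u + v - p.1) (c₁ * v - c₂ * u - c₁ * p.1) p.2}
  have hS : MeasurableSet S := (measurableSet_le (measurable_fst.const_mul _) measurable_const).inter
    ((measurableSet_staysBelow k).preimage (f := fun p : ℝ × (ℕ → ℝ) =>
      (u + v - p.1, c₁ * v - c₂ * u - c₁ * p.1, p.2)) (by fun_prop))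
  have hb : c₂ / c₁ * u = c₂ * u / c₁ := by ring
  have hlev : ∀ x, c₁ * x ≤ c₁ * v - c₂ * u ↔ x ≤ v - c₂ / c₁ * u := fun x => by
    rw [hb, le_sub_comm (a := x), div_le_iff₀ hc₁]
    constructor <;> intro h <;> linarith
  have h0 : 0 ≤ v - c₂ / c₁ * u := (hlev 0).1 (by linarith)
  refine (h.measureReal_eq_integral hlam hS (2 * k + 1) (u + v) le_rfl h0
    (f := fun _ => 0) (g := fun x => downVol (c₂ / c₁) k u (v - x)) (by fun_prop)
    ((continuous_downVol _ k u).comp (by fun_prop)) ?_ ?_ ?_).trans ?_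
  · intro x hx hx'
    exact absurd hx hx'.not_gt
  · intro x _ hx
    have hx' := (hlev x).2 hx
    rw [show u + v - x = u + (v - x) by ring, ← ih (v - x) (by linarith)]
    congr 1
    ext ω
    refine (and_iff_right hx').trans (iff_of_eq ?_)
    change StaysBelow _ _ _ _ _ _ = StaysBelow _ _ _ _ _ _
    congr 1 <;> ring
  · intro x hx
    have hx' : ¬ c₁ * x ≤ c₁ * v - c₂ * u := fun hc => hx.not_ge ((hlev x).1 hc)
    have : {ω | (x, fun i => W (i + 1) ω) ∈ S} = ∅ :=
      eq_empty_of_forall_notMem fun ω hω => hx' hω.1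
    rw [this, measureReal_empty]
  · rw [intervalIntegral.integral_same, zero_add,
      intervalIntegral.integral_comp_sub_left (fun x => downVol (c₂ / c₁) k u x), sub_zero,
      sub_sub_cancel, integral_downVol]

/-- The first downward run has two regimes, separated at length `u`: below it `v` is unchanged and
`u` shrinks, above it the level cannot be reached in the remaining time. -/
lemma measureReal_staysBelow_succ (hc₁ : 0 < c₁) (hc₂ : 0 < c₂) (hlam : 0 < lam)
    (h : IsExpSeq μ lam W) (k : ℕ) {u v : ℝ} (hu : 0 ≤ u) (hv : 0 ≤ v)
    (ih : ∀ x, 0 ≤ x → x ≤ u →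
      μ.real {ω | StaysBelowUp c₁ c₂ k (x + v) (c₁ * v - c₂ * x) fun i => W (i + 1) ω} =
        lam ^ (2 * k + 2) * Real.exp (-(lam * (x + v))) * upVol (c₂ / c₁) k x v) :
    μ.real {ω | StaysBelow c₁ c₂ (k + 1) (u + v) (c₁ * v - c₂ * u) fun i => W i ω} =
      lam ^ (2 * (k + 1) + 1) * Real.exp (-(lam * (u + v))) * downVol (c₂ / c₁) (k + 1) u v := by
  set S : Set (ℝ × (ℕ → ℝ)) :=
    {p | StaysBelowUp c₁ c₂ k (u + v - p.1) (c₁ * v - c₂ * u + c₂ * p.1) p.2}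
  have hS : MeasurableSet S := (measurableSet_staysBelowUp k).preimage
    (f := fun p : ℝ × (ℕ → ℝ) => (u + v - p.1, c₁ * v - c₂ * u + c₂ * p.1, p.2)) (by fun_prop)
  have h1 : {ω | StaysBelow c₁ c₂ (k + 1) (u + v) (c₁ * v - c₂ * u) fun i => W i ω} =
      {ω | (W 0 ω, fun i => W (i + 1) ω) ∈ S} := by
    ext ω
    exact staysBelow_succ _ _ _ _
  rw [h1]
  refine (h.measureReal_eq_integral hlam hS (2 * k + 2) (u + v) hu (b := u + v) (by linarith)
    (f := fun x => upVol (c₂ / c₁) k (u - x) v) (g := fun x => divPow (2 * k + 2) (u + v - x))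
    ((continuous_upVol _ k v).comp (by fun_prop))
    ((continuous_divPow _).comp (by fun_prop)) ?_ ?_ ?_).trans ?_
  · intro x hx hx'
    rw [show u + v - x = u - x + v by ring, ← ih (u - x) (by linarith) (by linarith)]
    congr 1
    ext ω
    change StaysBelowUp c₁ c₂ k (u + v - x) (c₁ * v - c₂ * u + c₂ * x) (fun i => W (i + 1) ω) ↔
      StaysBelowUp c₁ c₂ k (u - x + v) (c₁ * v - c₂ * (u - x)) (fun i => W (i + 1) ω)
    rw [show u + v - x = u - x + v by ring,
      show c₁ * v - c₂ * u + c₂ * x = c₁ * v - c₂ * (u - x) by ring]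
  · intro x hx hx'
    refine h.tail.measureReal_staysBelowUp_of_le hc₁ hc₂ hlam k (t := u + v - x)
      (β := c₁ * v - c₂ * u + c₂ * x) (by linarith) ?_
    -- The level exceeds `c₁` times the remaining time by exactly `(c₁ + c₂) * (x - u)`.
    nlinarith [mul_pos (add_pos hc₁ hc₂) (sub_pos.2 hx)]
  · intro x hx
    exact h.tail.measureReal_staysBelowUp_of_neg k (t := u + v - x)
      (β := c₁ * v - c₂ * u + c₂ * x) (by linarith)
  · rw [intervalIntegral.integral_comp_sub_left (fun x => upVol (c₂ / c₁) k x v),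
      intervalIntegral.integral_comp_sub_left (divPow (2 * k + 2)), sub_self, sub_zero, sub_self,
      add_sub_cancel_left, integral_divPow, divPow_zero_right, sub_zero, integral_upVol]
    rfl

/-- The probability that the path has `2 * k + 1` switches up to time `u + v` and stays below the
level `c₁ * v - c₂ * u`. -/
theorem measureReal_staysBelow (hc₁ : 0 < c₁) (hc₂ : 0 < c₂) (hlam : 0 < lam)
    (h : IsExpSeq μ lam W) (k : ℕ) {u v : ℝ} (hu : 0 ≤ u) (huv : c₂ * u ≤ c₁ * v) :
    μ.real {ω | StaysBelow c₁ c₂ k (u + v) (c₁ * v - c₂ * u) fun i => W i ω} =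
      lam ^ (2 * k + 1) * Real.exp (-(lam * (u + v))) * downVol (c₂ / c₁) k u v := by
  have hv : 0 ≤ v := by
    have : 0 ≤ c₂ * u := by positivity
    exact nonneg_of_mul_nonneg_right (this.trans huv) hc₁
  -- `W` varies because the induction step removes two interarrival times, one for each direction.
  induction k generalizing W u v with
  | zero =>
    rw [h.measureReal_staysBelow_zero hc₁ hc₂ hlam hu hv]
    simp [downVol, divPow]
  | succ k ih =>
    refine h.measureReal_staysBelow_succ hc₁ hc₂ hlam k hu hv fun x hx hxu => ?_
    have hxv : c₂ * x ≤ c₁ * v := (mul_le_mul_of_nonneg_left hxu hc₂.le).trans huv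
    refine h.tail.measureReal_staysBelowUp_of_staysBelow hc₁ hlam k hxv fun w hw => ?_
    refine ih h.tail.tail hx hw ?_
    have : 0 ≤ c₂ * x := by positivity
    exact nonneg_of_mul_nonneg_right (this.trans hw) hc₁

end IsExpSeq

end Below

/-! ### Paths -/

/-- Arrival times are monotone, so the counted indices form an initial segment of `ℕ`, which its
cardinality determines. -/
lemma le_iff_of_eq_encard {w : ℕ → ℝ} (hw : ∀ i, 0 ≤ w i) {t : ℝ} (ht : 0 ≤ t) {N : ℕ}
    (hN : (N : ℕ∞) = {n : ℕ | arrival w (n + 1) ≤ t}.encard) (n : ℕ) :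
    n ≤ N ↔ arrival w n ≤ t := by
  cases n with
  | zero => simpa [arrival_zero] using ht
  | succ n =>
    constructor
    · intro hn
      by_contra hc
      have hsub : {n : ℕ | arrival w (n + 1) ≤ t} ⊆ Iio n := fun m hm => by
        by_contra hmn
        exact hc ((arrival_mono hw (Nat.succ_le_succ (not_lt.1 hmn))).trans hm)
      have := encard_le_encard hsub
      rw [← hN, ← Finset.coe_Iio, encard_coe_eq_coe_finsetCard, Nat.card_Iio,
        Nat.cast_le] at this
      omega
    · intro hn
      have hsub : Iic n ⊆ {n : ℕ | arrival w (n + 1) ≤ t} := fun m hm =>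
        (arrival_mono hw (Nat.succ_le_succ hm)).trans hn
      have := encard_le_encard hsub
      rwa [← hN, ← Finset.coe_Iic, encard_coe_eq_coe_finsetCard, Nat.card_Iic,
        Nat.cast_le] at this

lemma eq_iff_countEq {w : ℕ → ℝ} {t : ℝ} {N : ℕ} (h : ∀ n, n ≤ N ↔ arrival w n ≤ t) (n : ℕ) :
    N = n ↔ CountEq n t w := by
  rw [CountEq, ← h, ← not_le, ← h]
  omega

/-- The integral of a function which is constant between consecutive arrival times. -/
lemma integral_of_const_between_arrivals {w ε : ℕ → ℝ} (hw : ∀ i, 0 ≤ w i) {f : ℝ → ℝ}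
    (hf : ∀ m u, CountEq m u w → f u = ε m) (m : ℕ) {s : ℝ} (hs : arrival w m ≤ s)
    (hs' : s ≤ arrival w (m + 1)) :
    IntervalIntegrable f volume 0 s ∧
      ∫ u in (0 : ℝ)..s, f u =
        ∑ i ∈ Finset.range m, ε i * w i + ε m * (s - arrival w m) := by
  have hstep : ∀ m s, arrival w m ≤ s → s ≤ arrival w (m + 1) →
      IntervalIntegrable f volume (arrival w m) s ∧
        ∫ u in (arrival w m)..s, f u = ε m * (s - arrival w m) := by
    intro m s hs hs'
    -- The right endpoint may be the next arrival, where `f` can take another value; it is a null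
    -- set.
    have hae : (fun _ => ε m) =ᵐ[volume.restrict (uIoc (arrival w m) s)] f := by
      rw [uIoc_of_le hs, ← restrict_Ioo_eq_restrict_Ioc]
      filter_upwards [ae_restrict_mem measurableSet_Ioo] with u hu
      exact (hf m u ⟨hu.1.le, hu.2.trans_le hs'⟩).symm
    refine ⟨intervalIntegrable_const.congr_ae hae, ?_⟩
    rw [← intervalIntegral.integral_congr_ae_restrict hae, intervalIntegral.integral_const,
      smul_eq_mul, mul_comm]
  induction m generalizing s with
  | zero => simpa [arrival_zero] using hstep 0 s hs hs'
  | succ m ih =>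
    obtain ⟨h1, h2⟩ := ih (arrival_mono hw m.le_succ) le_rfl
    obtain ⟨h3, h4⟩ := hstep (m + 1) s hs hs'
    refine ⟨h1.trans h3, ?_⟩
    rw [← intervalIntegral.integral_add_adjacent_intervals h1 h3, h2, h4, Finset.sum_range_succ,
      arrival_succ, add_sub_cancel_left]

section Path

variable {Ω : Type*} {c₁ c₂ : ℝ} {V₀ : Ω → ℝ} {N : ℝ≥0 → Ω → ℕ} {ω : Ω} {w : ℕ → ℝ}

lemma telegraphPosition_eq (hw : ∀ i, 0 ≤ w i)
    (hN : ∀ (s : ℝ≥0) n, n ≤ N s ω ↔ arrival w n ≤ s) (hV : V₀ ω = -c₂) (m : ℕ) {s : ℝ≥0}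
    (hs : arrival w m ≤ s) (hs' : (s : ℝ) ≤ arrival w (m + 1)) :
    telegraphPosition c₁ c₂ V₀ N s ω =
      switchPos c₁ c₂ w m + (if Even m then -c₂ else c₁) * (s - arrival w m) := by
  refine (integral_of_const_between_arrivals (ε := fun i => if Even i then -c₂ else c₁) hw ?_ m
    hs hs').2
  intro m u hu
  have hu0 : 0 ≤ u := (arrival_nonneg hw m).trans hu.1
  have hNm : N u.toNNReal ω = m :=
    (eq_iff_countEq (hN u.toNNReal) m).2 (by rwa [Real.coe_toNNReal u hu0])
  simp only [telegraphVelocity, hNm, hV]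
  congr 1
  ring

lemma telegraphMax_le_iff (hc₁ : 0 < c₁) (hc₂ : 0 < c₂) (hV : V₀ ω = -c₂) (t : ℝ≥0) (β : ℝ) :
    telegraphMax c₁ c₂ V₀ N t ω ≤ β ↔
      ∀ s ≤ t, telegraphPosition c₁ c₂ V₀ N s ω ≤ β := by
  rw [telegraphMax, csSup_le_iff]
  · simp
  -- Boundedness is needed since `sSup` of an unbounded set is `0`; the speed never exceeds `c₁ +
  -- c₂`.
  · refine ⟨(c₁ + c₂) * t, ?_⟩
    rintro _ ⟨s, hs, rfl⟩
    have h1 : ‖telegraphPosition c₁ c₂ V₀ N s ω‖ ≤ (c₁ + c₂) * |(s : ℝ) - 0| :=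
      intervalIntegral.norm_integral_le_of_norm_le_const fun u _ => by
        simp only [telegraphVelocity, hV, Real.norm_eq_abs, abs_le]
        split_ifs <;> constructor <;> linarith
    rw [sub_zero, abs_of_nonneg (NNReal.coe_nonneg s)] at h1
    exact (le_abs_self _).trans (h1.trans
      (mul_le_mul_of_nonneg_left (NNReal.coe_le_coe.2 hs.2) (by linarith)))
  · exact ⟨_, mem_image_of_mem _ ⟨le_rfl, t.2⟩⟩

/-- A piecewise linear path attains its maximum at time `0`, at the end of an upward run (an even
switch), or at `t`, where it is going up; `0 ≤ β` disposes of time `0`. -/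
lemma telegraphMax_le_iff_staysBelow (hc₁ : 0 < c₁) (hc₂ : 0 < c₂) (hw : ∀ i, 0 ≤ w i)
    (hN : ∀ (s : ℝ≥0) n, n ≤ N s ω ↔ arrival w n ≤ s) (hV : V₀ ω = -c₂) {k : ℕ} {t : ℝ≥0}
    (ht : N t ω = 2 * k + 1) {β : ℝ} (hβ : 0 ≤ β) :
    telegraphMax c₁ c₂ V₀ N t ω ≤ β ↔ StaysBelow c₁ c₂ k t β w := by
  have hcount := (eq_iff_countEq (hN t) _).1 ht
  have hodd : ¬ Even (2 * k + 1) := by simp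
  have hlast : telegraphPosition c₁ c₂ V₀ N t ω =
      switchPos c₁ c₂ w (2 * k + 1) + c₁ * (t - arrival w (2 * k + 1)) := by
    rw [telegraphPosition_eq hw hN hV _ hcount.1 hcount.2.le, if_neg hodd]
  have hswitch : ∀ n, telegraphPosition c₁ c₂ V₀ N ⟨arrival w n, arrival_nonneg hw n⟩ ω =
      switchPos c₁ c₂ w n := fun n => by
    rw [telegraphPosition_eq hw hN hV n (s := ⟨arrival w n, arrival_nonneg hw n⟩) le_rfl
      (arrival_mono hw n.le_succ)]
    change _ + _ * (arrival w n - arrival w n) = _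
    simp
  rw [telegraphMax_le_iff hc₁ hc₂ hV]
  constructor
  · intro h
    refine ⟨hcount, fun i hi => ?_, hlast ▸ h t le_rfl⟩
    rw [← hswitch]
    refine h _ (NNReal.coe_le_coe.1 ?_)
    exact (arrival_mono hw (show 2 * i + 2 ≤ 2 * k + 1 by omega)).trans hcount.1
  · rintro ⟨-, h1, h2⟩ s hst
    have hs := (eq_iff_countEq (hN s) _).1 rfl
    have hm : N s ω ≤ 2 * k + 1 := by
      rw [← ht, hN t]
      exact hs.1.trans (NNReal.coe_le_coe.2 hst)
    rw [telegraphPosition_eq hw hN hV _ hs.1 hs.2.le]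
    generalize N s ω = m at hs hm
    rcases Nat.even_or_odd' m with ⟨i, rfl | rfl⟩
    -- On a downward run the position is at most its value at the start of the run.
    · rw [if_pos (by simp)]
      have h3 : switchPos c₁ c₂ w (2 * i) ≤ β := by
        cases i with
        | zero => simpa [switchPos_zero] using hβ
        | succ i => exact h1 i (by omega)
      nlinarith [hs.1]
    -- On an upward run it is at most its value at the end: the next switch, or time `t` for the
    -- last run.
    · rw [if_neg (by simp)]
      rcases (show i ≤ k by omega).lt_or_eq with hik | rfl
      · have h3 := h1 i hik
        rw [switchPos_succ, if_neg (by simp)] at h3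
        have h4 := hs.2.le
        rw [arrival_succ] at h4
        nlinarith
      · have h4 := NNReal.coe_le_coe.2 hst
        nlinarith

end Path

/-! ### Independence of the initial velocity and the interarrival times -/

/-- The `n`-th arrival time of a counting path. -/
noncomputable def pathArrival (f : ℝ≥0 → ℕ) (n : ℕ) : ℝ :=
  (⨅ q : ℚ, if n ≤ f (q : ℝ).toNNReal then ((q : ℝ).toNNReal : ℝ≥0∞) else ⊤).toReal

/-- The infimum over rational times involves only countably many coordinates, hence is measurable
for the product σ-algebra. -/
lemma measurable_pathArrival (n : ℕ) : Measurable fun f => pathArrival f n := by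
  refine (Measurable.iInf fun q => ?_).ennreal_toReal
  exact .ite (measurableSet_le measurable_const (measurable_pi_apply _)) measurable_const
    measurable_const

lemma pathArrival_eq {f : ℝ≥0 → ℕ} {w : ℕ → ℝ} (hw : ∀ i, 0 ≤ w i)
    (hf : ∀ (s : ℝ≥0) n, n ≤ f s ↔ arrival w n ≤ s) (n : ℕ) : pathArrival f n = arrival w n := by
  have h0 := arrival_nonneg hw n
  suffices h : (⨅ q : ℚ, if n ≤ f (q : ℝ).toNNReal then ((q : ℝ).toNNReal : ℝ≥0∞) else ⊤) =
      ENNReal.ofReal (arrival w n) by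
    rw [pathArrival, h, ENNReal.toReal_ofReal h0]
  refine le_antisymm ?_ (le_iInf fun q => ?_)
  -- A rational time strictly between the arrival time and the infimum would itself belong to the
  -- infimum.
  · by_contra! hlt
    obtain ⟨q, hq0, hq1, hq2⟩ := ENNReal.lt_iff_exists_rat_btwn.1 hlt
    refine (iInf_le _ q).not_gt (hq2.trans_eq' ?_)
    refine (if_pos ((hf _ _).2 ?_)).symm
    exact Real.toNNReal_le_iff_le_coe.1 (ENNReal.coe_le_coe.1 hq1.le)
  · split_ifs with h
    · exact ENNReal.coe_le_coe.2 (Real.toNNReal_le_iff_le_coe.2 ((hf _ _).1 h))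
    · exact le_top

section Interarrival

variable {Ω : Type*} [MeasurableSpace Ω] {μ : Measure Ω} {lam : ℝ} {N : ℝ≥0 → Ω → ℕ}

/-- A Poisson process counts the arrivals given by a sequence of exponential interarrival times. -/
lemma IsPoissonProcess.exists_isExpSeq (h : IsPoissonProcess μ lam N) :
    ∃ W : ℕ → Ω → ℝ, IsExpSeq μ lam W ∧ (∀ᵐ ω ∂μ, ∀ i, 0 ≤ W i ω) ∧
      ∀ᵐ ω ∂μ, ∀ (s : ℝ≥0) n, n ≤ N s ω ↔ arrival (fun i => W i ω) n ≤ s := by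
  obtain ⟨W, hm, hl, hi, hN⟩ := h.exists_interarrival
  have hW : IsExpSeq μ lam W := ⟨hm, hl, hi⟩
  refine ⟨W, hW, hW.ae_nonneg, ?_⟩
  filter_upwards [hN, hW.ae_nonneg] with ω hω hω0 s n
  exact le_iff_of_eq_encard hω0 s.2 (hω s) n

lemma indepFun_interarrival {V₀ : Ω → ℝ} {W : ℕ → Ω → ℝ}
    (hind : IndepFun V₀ (fun ω s => N s ω) μ) (hW0 : ∀ᵐ ω ∂μ, ∀ i, 0 ≤ W i ω)
    (hN : ∀ᵐ ω ∂μ, ∀ (s : ℝ≥0) n, n ≤ N s ω ↔ arrival (fun i => W i ω) n ≤ s) :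
    IndepFun V₀ (fun ω i => W i ω) μ := by
  have hmeas : Measurable fun (f : ℝ≥0 → ℕ) i => pathArrival f (i + 1) - pathArrival f i :=
    measurable_pi_lambda _ fun i => (measurable_pathArrival _).sub (measurable_pathArrival _)
  refine (hind.comp measurable_id hmeas).congr (.refl _ _) ?_
  filter_upwards [hW0, hN] with ω hω0 hω
  funext i
  simp only [Function.comp, pathArrival_eq hω0 hω, arrival_succ, add_sub_cancel_left]

end Interarrival

/-! ### The conditional probability -/

lemma factorial_mul_divPow_mul_divPow {n j : ℕ} (hj : j ≤ n) {c t : ℝ} (hc : c ≠ 0) (x y : ℝ) :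
    n.factorial / t ^ n * (divPow j (x / c) * divPow (n - j) (y / c)) =
      n.choose j * (x ^ j * y ^ (n - j) / (c * t) ^ n) := by
  obtain ⟨m, rfl⟩ := Nat.exists_eq_add_of_le hj
  rw [Nat.add_sub_cancel_left, Nat.cast_add_choose, divPow, divPow, mul_pow, pow_add c, div_pow, div_pow]
  field_simp

lemma factorial_mul_downVol (k : ℕ) {c t : ℝ} (hc : c ≠ 0) (r x y : ℝ) :
    (2 * k + 1).factorial / t ^ (2 * k + 1) * downVol r k (x / c) (y / c) =
      ∑ j ∈ Finset.range (k + 1), ((2 * k + 1).choose j : ℝ) *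
          (x ^ j * y ^ (2 * k + 1 - j) / (c * t) ^ (2 * k + 1)) -
        ∑ j ∈ Finset.range k, ((2 * k + 1).choose j : ℝ) * r ^ (2 * k - 2 * j) *
          (x ^ (2 * k + 1 - j) * y ^ j / (c * t) ^ (2 * k + 1)) := by
  rw [downVol, mul_sub, Finset.mul_sum, Finset.mul_sum]
  congr 1
  · refine Finset.sum_congr rfl fun j hj => factorial_mul_divPow_mul_divPow ?_ hc x y
    have := Finset.mem_range.1 hj
    omega
  · refine Finset.sum_congr rfl fun j hj => ?_
    have hj' : j ≤ 2 * k + 1 := by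
      have := Finset.mem_range.1 hj
      omega
    -- In the second sum the exponent `j` sits on `y`, so the roles of `x` and `y` are exchanged.
    have h := factorial_mul_divPow_mul_divPow hj' (t := t) hc y x
    rw [← Nat.mul_sub]
    linear_combination r ^ (2 * (k - j)) * h

theorem theorem3p2 {Ω : Type*} [MeasurableSpace Ω] (μ : Measure Ω) [IsProbabilityMeasure μ]
    (c₁ c₂ lam : ℝ) (hc₁ : 0 < c₁) (hc₂ : 0 < c₂) (hlam : 0 < lam)
    (V₀ : Ω → ℝ) (N : ℝ≥0 → Ω → ℕ) (hVN : IsTelegraphDriver μ c₁ c₂ lam V₀ N)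
    (k : ℕ) (t : ℝ≥0) (ht : 0 < t) (β : ℝ) (hβ : β ∈ Icc 0 (c₁ * (t : ℝ))) :
    (μ[|{ω | V₀ ω = -c₂ ∧ N t ω = 2 * k + 1}]).real
        {ω | telegraphMax c₁ c₂ V₀ N t ω ≤ β} =
      ∑ j ∈ Finset.range (k + 1), ((2 * k + 1).choose j : ℝ) *
          ((c₁ * t - β) ^ j * (c₂ * t + β) ^ (2 * k + 1 - j) / ((c₁ + c₂) * t) ^ (2 * k + 1)) -
        ∑ j ∈ Finset.range k, ((2 * k + 1).choose j : ℝ) * (c₂ / c₁) ^ (2 * k - 2 * j) *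
          ((c₁ * t - β) ^ (2 * k + 1 - j) * (c₂ * t + β) ^ j /
            ((c₁ + c₂) * t) ^ (2 * k + 1)) := by
  obtain ⟨W, hW, hW0, hN⟩ := hVN.poisson.exists_isExpSeq
  have hind := indepFun_interarrival hVN.indep hW0 hN
  have hc : 0 < c₁ + c₂ := by linarith
  have ht' : (0 : ℝ) < t := ht
  have hprod : ∀ S : Set (ℕ → ℝ), MeasurableSet S →
      μ.real {ω | V₀ ω = -c₂ ∧ (fun i => W i ω) ∈ S} =
        2⁻¹ * μ.real {ω | (fun i => W i ω) ∈ S} := by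
    intro S hS
    have h1 := hind.measure_inter_preimage_eq_mul {-c₂} S (measurableSet_singleton _) hS
    have h2 : μ (V₀ ⁻¹' {-c₂}) = 1 / 2 := hVN.initial_neg
    rw [h2] at h1
    have h3 := congrArg ENNReal.toReal h1
    rw [ENNReal.toReal_mul, one_div, ENNReal.toReal_inv, ENNReal.toReal_ofNat] at h3
    exact h3
  have hden : μ.real {ω | V₀ ω = -c₂ ∧ N t ω = 2 * k + 1} =
      2⁻¹ * (lam ^ (2 * k + 1) * Real.exp (-(lam * t)) *
        ((t : ℝ) ^ (2 * k + 1) / (2 * k + 1).factorial)) := by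
    rw [← hW.measureReal_countEq hlam _ ht'.le]
    refine Eq.trans ?_ (hprod {w | CountEq (2 * k + 1) t w} ((measurableSet_countEq _).preimage
      (f := fun w => ((t : ℝ), w)) (by fun_prop)))
    refine measureReal_congr ?_
    filter_upwards [hN] with ω hω
    exact propext (and_congr_right fun _ => eq_iff_countEq (hω t) _)
  have hnum : μ.real ({ω | V₀ ω = -c₂ ∧ N t ω = 2 * k + 1} ∩
        {ω | telegraphMax c₁ c₂ V₀ N t ω ≤ β}) =
      2⁻¹ * (lam ^ (2 * k + 1) * Real.exp (-(lam * t)) *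
        downVol (c₂ / c₁) k ((c₁ * t - β) / (c₁ + c₂)) ((c₂ * t + β) / (c₁ + c₂))) := by
    -- These values of `u` and `v` solve `u + v = t`, `c₁ * v - c₂ * u = β`; the condition `c₂ * u ≤
    -- c₁ * v` is then `0 ≤ β`, and `0 ≤ u` is `β ≤ c₁ * t`.
    have hu : 0 ≤ (c₁ * t - β) / (c₁ + c₂) := div_nonneg (by linarith [hβ.2]) hc.le
    have htuv : (c₁ * t - β) / (c₁ + c₂) + (c₂ * t + β) / (c₁ + c₂) = t := by
      field_simp
      ring
    have hβuv : c₁ * ((c₂ * t + β) / (c₁ + c₂)) - c₂ * ((c₁ * t - β) / (c₁ + c₂)) = β := by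
      field_simp
      ring
    have h := hW.measureReal_staysBelow hc₁ hc₂ hlam k hu (v := (c₂ * t + β) / (c₁ + c₂))
      (by linarith [hβ.1])
    rw [htuv, hβuv] at h
    rw [← h]
    refine Eq.trans ?_ (hprod {w | StaysBelow c₁ c₂ k t β w} ((measurableSet_staysBelow _).preimage
      (f := fun w => ((t : ℝ), β, w)) (by fun_prop)))
    refine measureReal_congr ?_
    filter_upwards [hN, hW0] with ω hω hω0
    refine propext (and_assoc.trans (and_congr_right fun hV => ?_))
    constructor
    · rintro ⟨h1, h2⟩
      exact (telegraphMax_le_iff_staysBelow hc₁ hc₂ hω0 hω hV h1 hβ.1).1 h2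
    · intro h1
      have h2 := (eq_iff_countEq (hω t) _).2 h1.1
      exact ⟨h2, (telegraphMax_le_iff_staysBelow hc₁ hc₂ hω0 hω hV h2 hβ.1).2 h1⟩
  have hmeas : MeasurableSet {ω | V₀ ω = -c₂ ∧ N t ω = 2 * k + 1} :=
    (hVN.measurable_initial (measurableSet_singleton _)).inter
      (hVN.poisson.measurable t (measurableSet_singleton _))
  rw [measureReal_def, cond_apply hmeas, ENNReal.toReal_mul, ENNReal.toReal_inv,
    ← measureReal_def, ← measureReal_def, hden, hnum, ← factorial_mul_downVol k hc.ne']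
  -- The factors `2⁻¹`, `lam ^ (2 * k + 1)` and the exponential cancel in the ratio.
  have := Real.exp_ne_zero (-(lam * t))
  field_simp
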